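/- Strings are finite binary strings, $|x|$ is the length of $x$, and $[x,y]=0^{|x|}1xy$ encodes the pair $(x,y)$. A programming language is a partial computable function $F:\{0,1\}^*\times\{0,1\}^*\to\{0,1\}^*$ (program and input to output). A programming language $U$ is optimal if for every programming language $F$ there is a string $t$ such that $U(tp,x)=F(p,x)$ for all $p,x$. For an optimal $U$ let $C(x|y)=\min\{|p| : U(p,y)=x\}$ and $C(x)=C(x|\text{empty string})$; write $C(x,y)=C([x,y])$, $C(z|x,y)=C(z|[x,y])$ and $C(x,y|z)=C([x,y]|z)$. Theorem. For every optimal programming language $U$ there is a constant $c$ such that for every natural number $\varepsilon$ there exist strings $x,y,z$, each of length at most $5\varepsilon+c$, with the following property: for all strings $p,q$, the inequalities $$C(y|p,x)<\varepsilon,\quad C(z|q,y)<\varepsilon,\quad C(p)<C(y|x)+\varepsilon-c,\quad C(q)<C(z|y)+\varepsilon-c$$ imply $$C(p,q)\ \ge\ \max\{C(y,z|x),\,C(z|y)\}+\varepsilon-c .$$ In other words, no strings $p,q$ with $C(y|p,x)<\varepsilon$ and $C(z|q,y)<\varepsilon$ satisfy simultaneously $C(p)<C(y|x)+\varepsilon-c$,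 $C(q)<C(z|y)+\varepsilon-c$ and $C(p,q)<\max\{C(y,z|x),C(z|y)\}+\varepsilon-c$. -/

import Mathlib

/-- A programming language: a partial computable function `F` from pairs of binary strings
(program, input) to binary strings (output). Strings are lists of bits. -/
def IsProgrammingLanguage (F : List Bool → List Bool →. List Bool) : Prop :=
  Partrec₂ F

/-- A programming language `U` is optimal if every programming language `F` is simulated by `U`
after prepending a fixed string `t` to its programs (equality of partial values: `U (t ++ p) x`
is defined exactly when `F p x` is, and then they agree). -/
def IsOptimal (U : List Bool → List Bool →. List Bool) : Prop :=
  IsProgrammingLanguage U ∧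
    ∀ F : List Bool → List Bool →. List Bool, IsProgrammingLanguage F →
      ∃ t : List Bool, ∀ p x : List Bool, U (t ++ p) x = F p x

/-- The encoding `[x, y] = 0^{|x|} 1 x y` of a pair of strings by a string. -/
def pairStr (x y : List Bool) : List Bool :=
  List.replicate x.length false ++ true :: (x ++ y)

/-- Conditional Kolmogorov complexity `C(x | y)` with respect to `U`: the least length of a
program that outputs `x` on input `y`. -/
noncomputable def condC (U : List Bool → List Bool →. List Bool) (x y : List Bool) : ℕ :=
  sInf {n : ℕ | ∃ p : List Bool, p.length = n ∧ x ∈ U p y}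

/-- Kolmogorov complexity `C(x) = C(x | empty string)`. -/
noncomputable def plainC (U : List Bool → List Bool →. List Bool) (x : List Bool) : ℕ :=
  condC U x []

/-- For an optimal `U` the minimum defining `C(x | y)` is over a nonempty set, so it is attained
by a program. -/
theorem exists_program_of_isOptimal {U : List Bool → List Bool →. List Bool}
    (hU : IsOptimal U) (x y : List Bool) :
    ∃ p : List Bool, p.length = condC U x y ∧ x ∈ U p y := by
  obtain ⟨t, ht⟩ := hU.2 (fun p _ => Part.some p) Computable.fst
  have hne : {n : ℕ | ∃ p : List Bool, p.length = n ∧ x ∈ U p y}.Nonempty :=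
    ⟨(t ++ x).length, t ++ x, rfl, by rw [ht]; exact Part.mem_some x⟩
  exact Nat.sInf_mem hne

/-! A game against the enumeration of `U`, played with |x| = 5ε, |y| = 3ε, |z| = 5ε. Rounds are the
2^(10ε) pairs (x, w) with |x| = |w| = 5ε. In round (x, w) one picks a pair (y, z) that no cheap (p,
q) is yet seen to serve for x, and waits until one does. Here cheap means complexities below 4ε - 2,
6ε - 2 and 6ε - 2 for p, q and [p, q].

A move always exists (`exists_not_covered`): a served (y, z) is determined by programs of lengths
below 6ε - 2, ε and ε, too few for 2^(8ε) pairs. Each completed round consumes a halting event not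
seen before (`eventCount_lt_eventCount`), and there are fewer than 2^(10ε) events (`eventCount_lt`).
So some round never ends (`exists_never_covered`), and its triple is never served.

The play is computable, so w describes (y, z) given x and C(y,z|x) ≤ 5ε + O(1); trivially C(y|x) ≤
3ε + O(1) and C(z|y) ≤ 5ε + O(1). Hence p, q violating the theorem would be cheap and would serve
the triple. -/

/-- A primitive recursive, monotone approximation by stages of a partial function `U` of two
strings. -/
structure IsStaging (U : List Bool → List Bool →. List Bool)
    (run : ℕ → List Bool → List Bool → Option (List Bool)) : Prop where
  primrec : Primrec fun v : ℕ × List Bool × List Bool => run v.1 v.2.1 v.2.2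
  mono : ∀ {s s' a x w}, s ≤ s' → run s a x = some w → run s' a x = some w
  complete : ∀ {a x w}, w ∈ U a x ↔ ∃ s, run s a x = some w

/-- Stages are the bounds of `evaln` for a code of `U`. -/
theorem exists_isStaging {U : List Bool → List Bool →. List Bool} (hU : IsProgrammingLanguage U) :
    ∃ run, IsStaging U run := by
  obtain ⟨c, hc⟩ := Nat.Partrec.Code.exists_code.1 hU
  refine ⟨fun s a x => (Nat.Partrec.Code.evaln s c (Encodable.encode (a, x))).bind
    Encodable.decode, ?_, ?_, ?_⟩
  · refine Primrec.option_bind ?_ (Primrec.decode.comp Primrec.snd).to₂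
    exact Nat.Partrec.Code.primrec_evaln.comp
      ((Primrec.fst.pair (Primrec.const c)).pair (Primrec.encode.comp Primrec.snd))
  · intro s s' a x w h h1
    obtain ⟨n, hn, hw⟩ := Option.bind_eq_some_iff.1 h1
    exact Option.bind_eq_some_iff.2 ⟨n, Nat.Partrec.Code.evaln_mono h hn, hw⟩
  · intro a x w
    have key : ∀ n, n ∈ c.eval (Encodable.encode (a, x)) ↔
        ∃ v ∈ U a x, Encodable.encode v = n := by
      intro n
      rw [hc]
      simp
    constructor
    · intro h
      obtain ⟨k, hk⟩ := Nat.Partrec.Code.evaln_complete.1 ((key _).2 ⟨w, h, rfl⟩)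
      exact ⟨k, Option.bind_eq_some_iff.2 ⟨_, hk, Encodable.encodek w⟩⟩
    · rintro ⟨s, hs⟩
      obtain ⟨n, hn, hw⟩ := Option.bind_eq_some_iff.1 hs
      obtain ⟨v, hv, rfl⟩ := (key n).1 (Nat.Partrec.Code.evaln_sound hn)
      rw [Encodable.encodek] at hw
      exact Option.some_injective _ hw ▸ hv

/-! ### Pairing and bounded search over strings -/

theorem pairStr_inj {p q p' q' : List Bool} (h : pairStr p q = pairStr p' q') :
    p = p' ∧ q = q' := by
  have hlen : p.length = p'.length := by
    have key : ∀ (m n : ℕ) (u v : List Bool), List.replicate m false ++ true :: u =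
        List.replicate n false ++ true :: v → m = n := by
      intro m
      induction m with
      | zero =>
        intro n u v h
        cases n with
        | zero => rfl
        | succ n => simp [List.replicate_succ] at h
      | succ m ih =>
        intro n u v h
        cases n with
        | zero => simp [List.replicate_succ] at h
        | succ n =>
          simp only [List.replicate_succ, List.cons_append, List.cons.injEq, true_and] at h
          rw [ih n u v h]
    exact key _ _ _ _ h
  unfold pairStr at h
  rw [hlen] at h
  simp only [List.append_cancel_left_eq, List.cons.injEq, true_and] at h
  exact List.append_inj h hlen

theorem primrec_pairStr : Primrec₂ pairStr := by
  have h : Primrec fun v : List Bool × List Bool =>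
      v.1.map (fun _ => false) ++ true :: (v.1 ++ v.2) :=
    Primrec.list_append.comp
      (Primrec.list_map Primrec.fst (Primrec.const false).to₂)
      (Primrec.list_cons.comp (Primrec.const true)
        (Primrec.list_append.comp Primrec.fst Primrec.snd))
  refine h.of_eq fun v => ?_
  simp [pairStr]

/-- The strings with code below `s`. -/
def stringsBelow (s : ℕ) : List (List Bool) :=
  (List.range s).map fun n => (Encodable.decode n).getD []

theorem primrec_stringsBelow : Primrec stringsBelow :=
  Primrec.list_map Primrec.list_range
    ((Primrec.option_getD.comp (Primrec.decode.comp Primrec.snd) (Primrec.const [])).to₂)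

theorem stringsBelow_mono {s s' : ℕ} (h : s ≤ s') {w : List Bool} (hw : w ∈ stringsBelow s) :
    w ∈ stringsBelow s' := by
  simp only [stringsBelow, List.mem_map, List.mem_range] at hw ⊢
  obtain ⟨n, hn, rfl⟩ := hw
  exact ⟨n, hn.trans_le h, rfl⟩

theorem exists_mem_stringsBelow (w : List Bool) : ∃ s, w ∈ stringsBelow s := by
  refine ⟨Encodable.encode w + 1, ?_⟩
  simp only [stringsBelow, List.mem_map, List.mem_range]
  exact ⟨Encodable.encode w, Nat.lt_succ_self _, by simp⟩

theorem PrimrecPred.exists_mem_stringsBelow {α : Type*} [Primcodable α] {s : α → ℕ}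
    {R : α → List Bool → Prop} (hs : Primrec s) (hR : PrimrecPred fun v : α × List Bool => R v.1 v.2) :
    PrimrecPred fun a => ∃ w ∈ stringsBelow (s a), R a w := by
  have h : PrimrecRel fun (w : List Bool) (a : α) => R a w :=
    hR.comp (Primrec.snd.pair Primrec.fst)
  exact h.exists_mem_list.comp (primrec_stringsBelow.comp hs) Primrec.id

/-! ### The winning condition of the game is primitive recursive -/

section Game

variable (run : ℕ → List Bool → List Bool → Option (List Bool))

/-- At stage `s` a program of length less than `m - 2` for `p` is known, and a program of length
less than `ε` producing `y` from `[p, x]`. -/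
def Reaches (s m ε : ℕ) (x p y : List Bool) : Prop :=
  ∃ a ∈ stringsBelow s, ∃ e ∈ stringsBelow s, a.length + 2 < m ∧ e.length < ε ∧
    run s a [] = some p ∧ run s e (pairStr p x) = some y

/-- At stage `s` the triple `(x, y, z)` is known to be served by a pair `(p, q)` of low
complexity. -/
def Covered (s ε : ℕ) (x y z : List Bool) : Prop :=
  ∃ p ∈ stringsBelow s, ∃ q ∈ stringsBelow s, ∃ d ∈ stringsBelow s,
    Reaches run s (4 * ε) ε x p y ∧ Reaches run s (6 * ε) ε y q z ∧
      d.length + 2 < 6 * ε ∧ run s d [] = some (pairStr p q)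

variable {run}

theorem primrecPred_reaches
    (hr : Primrec fun v : ℕ × List Bool × List Bool => run v.1 v.2.1 v.2.2)
    {α : Type*} [Primcodable α] {s m ε : α → ℕ} {x p y : α → List Bool} (hs : Primrec s)
    (hm : Primrec m) (hε : Primrec ε) (hx : Primrec x) (hp : Primrec p) (hy : Primrec y) :
    PrimrecPred fun a => Reaches run (s a) (m a) (ε a) (x a) (p a) (y a) := by
  unfold Reaches
  refine PrimrecPred.exists_mem_stringsBelow hs
    (PrimrecPred.exists_mem_stringsBelow (hs.comp Primrec.fst) ?_)
  have i : Primrec fun v : (α × List Bool) × List Bool => v.1.1 := Primrec.fst.comp Primrec.fst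
  have ha : Primrec fun v : (α × List Bool) × List Bool => v.1.2 := Primrec.snd.comp Primrec.fst
  refine PrimrecPred.and (Primrec.nat_lt.comp
    (Primrec.nat_add.comp (Primrec.list_length.comp ha) (Primrec.const 2)) (hm.comp i)) ?_
  refine PrimrecPred.and (Primrec.nat_lt.comp (Primrec.list_length.comp Primrec.snd)
    (hε.comp i)) ?_
  refine PrimrecPred.and (Primrec.eq.comp
    (hr.comp ((hs.comp i).pair (ha.pair (Primrec.const []))))
    (Primrec.option_some.comp (hp.comp i))) ?_
  exact Primrec.eq.comp
    (hr.comp ((hs.comp i).pair (Primrec.snd.pair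
      (primrec_pairStr.comp (hp.comp i) (hx.comp i)))))
    (Primrec.option_some.comp (hy.comp i))

theorem primrecPred_covered
    (hr : Primrec fun v : ℕ × List Bool × List Bool => run v.1 v.2.1 v.2.2)
    {α : Type*} [Primcodable α] {s ε : α → ℕ} {x y z : α → List Bool} (hs : Primrec s)
    (hε : Primrec ε) (hx : Primrec x) (hy : Primrec y) (hz : Primrec z) :
    PrimrecPred fun a => Covered run (s a) (ε a) (x a) (y a) (z a) := by
  unfold Covered
  refine PrimrecPred.exists_mem_stringsBelow hs
    (PrimrecPred.exists_mem_stringsBelow (hs.comp Primrec.fst)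
      (PrimrecPred.exists_mem_stringsBelow (hs.comp (Primrec.fst.comp Primrec.fst)) ?_))
  have i : Primrec fun v : ((α × List Bool) × List Bool) × List Bool => v.1.1.1 :=
    Primrec.fst.comp (Primrec.fst.comp Primrec.fst)
  have hp : Primrec fun v : ((α × List Bool) × List Bool) × List Bool => v.1.1.2 :=
    Primrec.snd.comp (Primrec.fst.comp Primrec.fst)
  have hq : Primrec fun v : ((α × List Bool) × List Bool) × List Bool => v.1.2 :=
    Primrec.snd.comp Primrec.fst
  have h4 : Primrec fun v : ((α × List Bool) × List Bool) × List Bool => 4 * ε v.1.1.1 :=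
    Primrec.nat_mul.comp (Primrec.const 4) (hε.comp i)
  have h6 : Primrec fun v : ((α × List Bool) × List Bool) × List Bool => 6 * ε v.1.1.1 :=
    Primrec.nat_mul.comp (Primrec.const 6) (hε.comp i)
  refine PrimrecPred.and (primrecPred_reaches hr (hs.comp i) h4 (hε.comp i) (hx.comp i) hp
    (hy.comp i)) ?_
  refine PrimrecPred.and (primrecPred_reaches hr (hs.comp i) h6 (hε.comp i) (hy.comp i) hq
    (hz.comp i)) ?_
  refine PrimrecPred.and (Primrec.nat_lt.comp
    (Primrec.nat_add.comp (Primrec.list_length.comp Primrec.snd) (Primrec.const 2)) h6) ?_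
  exact Primrec.eq.comp
    (hr.comp ((hs.comp i).pair (Primrec.snd.pair (Primrec.const []))))
    (Primrec.option_some.comp (primrec_pairStr.comp hp hq))

end Game

/-! ### Counting strings and halting events -/

/-- The strings of length `n`. -/
def stringsOfLength (n : ℕ) : Finset (List Bool) :=
  (Finset.univ : Finset (List.Vector Bool n)).map ⟨List.Vector.toList, List.Vector.toList_injective⟩

theorem mem_stringsOfLength {n : ℕ} {w : List Bool} : w ∈ stringsOfLength n ↔ w.length = n := by
  simp only [stringsOfLength, Finset.mem_map, Finset.mem_univ, true_and]
  exact ⟨fun ⟨v, hv⟩ => hv ▸ v.2, fun h => ⟨⟨w, h⟩, rfl⟩⟩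

theorem card_stringsOfLength (n : ℕ) : (stringsOfLength n).card = 2 ^ n := by
  simp [stringsOfLength, card_vector]

/-- The strings of length less than `n`. -/
def shortStrings (n : ℕ) : Finset (List Bool) :=
  (Finset.range n).biUnion stringsOfLength

theorem mem_shortStrings {n : ℕ} {w : List Bool} : w ∈ shortStrings n ↔ w.length < n := by
  simp [shortStrings, mem_stringsOfLength]

theorem card_shortStrings_lt (n : ℕ) : (shortStrings n).card < 2 ^ n := by
  refine (Finset.card_biUnion_le).trans_lt ?_
  simp only [card_stringsOfLength]
  exact Nat.geomSum_lt le_rfl (fun k hk => Finset.mem_range.1 hk)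

theorem four_mul_card_shortStrings_le (n : ℕ) : 4 * (shortStrings (n - 2)).card ≤ 2 ^ n := by
  rcases lt_or_ge n 2 with h | h
  · have : n - 2 = 0 := by omega
    simp [this, shortStrings]
  · obtain ⟨m, rfl⟩ := Nat.exists_eq_add_of_le' h
    have := card_shortStrings_lt m
    rw [Nat.add_sub_cancel, pow_add]
    omega

section Counting

variable (run : ℕ → List Bool → List Bool → Option (List Bool))

/-- At stage `s` the program `a` is known to produce some `p`, and the program `e` is known to
produce something from `[p, x]`. -/
def LinkHalts (s : ℕ) (v : List Bool × List Bool × List Bool) : Prop :=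
  v.2.1 ∈ stringsBelow s ∧ v.2.2 ∈ stringsBelow s ∧ ∃ p ∈ stringsBelow s,
    run s v.2.1 [] = some p ∧ ∃ y, run s v.2.2 (pairStr p v.1) = some y

/-- At stage `s` the program `d` is known to halt on the empty input. -/
def PairHalts (s : ℕ) (d : List Bool) : Prop :=
  d ∈ stringsBelow s ∧ ∃ w, run s d [] = some w

/-- The possible links at inputs of length `n`: an input, a program for `p` and a short program
used on `[p, x]`. -/
def links (n m ε : ℕ) : Finset (List Bool × List Bool × List Bool) :=
  stringsOfLength n ×ˢ shortStrings (m - 2) ×ˢ shortStrings ε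

theorem four_mul_card_links_le (n m ε : ℕ) : 4 * (links n m ε).card ≤ 2 ^ (n + m + ε) := by
  rw [links, Finset.card_product, Finset.card_product, card_stringsOfLength, pow_add, pow_add]
  calc 4 * (2 ^ n * ((shortStrings (m - 2)).card * (shortStrings ε).card))
      = 2 ^ n * (4 * (shortStrings (m - 2)).card) * (shortStrings ε).card := by ring
    _ ≤ 2 ^ n * 2 ^ m * 2 ^ ε := by
      gcongr
      · exact four_mul_card_shortStrings_le m
      · exact (card_shortStrings_lt ε).le

open Classical in
/-- The number of halting events observed by stage `s`. -/
noncomputable def eventCount (ε s : ℕ) : ℕ :=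
  ((links (5 * ε) (4 * ε) ε).filter (LinkHalts run s)).card +
    ((links (3 * ε) (6 * ε) ε).filter (LinkHalts run s)).card +
    ((shortStrings (6 * ε - 2)).filter (PairHalts run s)).card

/-- The exponents 5 + 4 + 1 and 3 + 6 + 1 balance at 10, and 6 is below it. The 2 subtracted from
the program lengths makes each of the three counts at most a quarter of the bound. -/
theorem eventCount_lt (ε s : ℕ) : eventCount run ε s < 2 ^ (10 * ε) := by
  classical
  have h1 := Finset.card_filter_le (links (5 * ε) (4 * ε) ε) (LinkHalts run s)
  have h2 := Finset.card_filter_le (links (3 * ε) (6 * ε) ε) (LinkHalts run s)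
  have h3 := Finset.card_filter_le (shortStrings (6 * ε - 2)) (PairHalts run s)
  have h4 := four_mul_card_links_le (5 * ε) (4 * ε) ε
  have h5 := four_mul_card_links_le (3 * ε) (6 * ε) ε
  have h6 := four_mul_card_shortStrings_le (6 * ε)
  rw [show 5 * ε + 4 * ε + ε = 10 * ε by ring] at h4
  rw [show 3 * ε + 6 * ε + ε = 10 * ε by ring] at h5
  have h7 : 2 ^ (6 * ε) ≤ 2 ^ (10 * ε) := Nat.pow_le_pow_right two_pos (by omega)
  have h8 : 0 < 2 ^ (10 * ε) := by positivity
  unfold eventCount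
  omega

variable {run}
variable {U : List Bool → List Bool →. List Bool}

theorem run_unique (hU : IsStaging U run) {s s' : ℕ} {a x w w' : List Bool} (h : run s a x = some w)
    (h' : run s' a x = some w') : w = w' := by
  have h1 := hU.mono (le_max_left s s') h
  have h2 := hU.mono (le_max_right s s') h'
  exact Option.some_injective _ (h1.symm.trans h2)

theorem Reaches.mono (hU : IsStaging U run) {s s' m ε : ℕ} {x p y : List Bool} (hs : s ≤ s')
    (h : Reaches run s m ε x p y) : Reaches run s' m ε x p y := by
  obtain ⟨a, ha, e, he, h1, h2, h3, h4⟩ := h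
  exact ⟨a, stringsBelow_mono hs ha, e, stringsBelow_mono hs he, h1, h2, hU.mono hs h3, hU.mono hs h4⟩

theorem Covered.mono (hU : IsStaging U run) {s s' ε : ℕ} {x y z : List Bool} (hs : s ≤ s')
    (h : Covered run s ε x y z) : Covered run s' ε x y z := by
  obtain ⟨p, hp, q, hq, d, hd, h1, h2, h3, h4⟩ := h
  exact ⟨p, stringsBelow_mono hs hp, q, stringsBelow_mono hs hq, d, stringsBelow_mono hs hd,
    h1.mono hU hs, h2.mono hU hs, h3, hU.mono hs h4⟩

theorem LinkHalts.mono (hU : IsStaging U run) {s s' : ℕ} {v : List Bool × List Bool × List Bool} (hs : s ≤ s')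
    (h : LinkHalts run s v) : LinkHalts run s' v := by
  obtain ⟨h1, h2, p, hp, h3, y, h4⟩ := h
  exact ⟨stringsBelow_mono hs h1, stringsBelow_mono hs h2, p, stringsBelow_mono hs hp,
    hU.mono hs h3, y, hU.mono hs h4⟩

theorem PairHalts.mono (hU : IsStaging U run) {s s' : ℕ} {d : List Bool} (hs : s ≤ s')
    (h : PairHalts run s d) : PairHalts run s' d := by
  obtain ⟨h1, w, h2⟩ := h
  exact ⟨stringsBelow_mono hs h1, w, hU.mono hs h2⟩

/-- If the link witnessing `Reaches` at one stage is already observed at another stage, then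
`Reaches` holds there as well. -/
theorem Reaches.of_links (hU : IsStaging U run) {s s' n m ε : ℕ} {x p y : List Bool}
    (hx : x.length = n)
    (hp : p ∈ stringsBelow s') (h : Reaches run s' m ε x p y)
    (hl : ∀ v ∈ links n m ε, LinkHalts run s' v → LinkHalts run s v) :
    p ∈ stringsBelow s ∧ Reaches run s m ε x p y := by
  obtain ⟨a, ha, e, he, h1, h2, h3, h4⟩ := h
  have hv : (x, a, e) ∈ links n m ε := by
    simp only [links, Finset.mem_product, mem_stringsOfLength, mem_shortStrings]
    omega
  obtain ⟨ha', he', p', hp', h3', y', h4'⟩ := hl _ hv ⟨ha, he, p, hp, h3, y, h4⟩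
  -- `LinkHalts` does not name the outputs; determinism forces them to be the same `p` and `y`.
  obtain rfl := run_unique hU h3 h3'
  obtain rfl := run_unique hU h4 h4'
  exact ⟨hp', a, ha', e, he', h1, h2, h3', h4'⟩

/-- A cover is witnessed by two links and one program for the pair. If all three had already been
observed at stage `s`, the triple would have been covered then. -/
theorem eventCount_lt_eventCount (hU : IsStaging U run) {s s' ε : ℕ} {x y z : List Bool} (hx : x.length = 5 * ε)
    (hy : y.length = 3 * ε) (hn : ¬ Covered run s ε x y z) (hc : Covered run s' ε x y z) :
    eventCount run ε s < eventCount run ε s' := by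
  classical
  have hs : s ≤ s' := by
    by_contra hlt
    exact hn (hc.mono hU (by omega))
  by_contra hle
  unfold eventCount at hle
  have sub1 : ∀ n m, (links n m ε).filter (LinkHalts run s) ⊆
      (links n m ε).filter (LinkHalts run s') := fun n m =>
    Finset.monotone_filter_right _ fun v _ h => h.mono hU hs
  have sub2 : (shortStrings (6 * ε - 2)).filter (PairHalts run s) ⊆
      (shortStrings (6 * ε - 2)).filter (PairHalts run s') :=
    Finset.monotone_filter_right _ fun v _ h => h.mono hU hs
  have c1 := Finset.card_le_card (sub1 (5 * ε) (4 * ε))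
  have c2 := Finset.card_le_card (sub1 (3 * ε) (6 * ε))
  have c3 := Finset.card_le_card sub2
  -- Event sets only grow, so a total that does not increase leaves each of the three unchanged.
  have e1 := Finset.eq_of_subset_of_card_le (sub1 (5 * ε) (4 * ε)) (by omega)
  have e2 := Finset.eq_of_subset_of_card_le (sub1 (3 * ε) (6 * ε)) (by omega)
  have e3 := Finset.eq_of_subset_of_card_le sub2 (by omega)
  obtain ⟨p, hp, q, hq, d, hd, h1, h2, h3, h4⟩ := hc
  obtain ⟨hp', h1'⟩ := h1.of_links (s := s) hU hx hp fun v hv hl =>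
    (Finset.mem_filter.1 (e1.symm ▸ Finset.mem_filter.2 ⟨hv, hl⟩)).2
  obtain ⟨hq', h2'⟩ := h2.of_links (s := s) hU hy hq fun v hv hl =>
    (Finset.mem_filter.1 (e2.symm ▸ Finset.mem_filter.2 ⟨hv, hl⟩)).2
  have hd' : d ∈ shortStrings (6 * ε - 2) := mem_shortStrings.2 (by omega)
  have hd2 : d ∈ (shortStrings (6 * ε - 2)).filter (PairHalts run s') :=
    Finset.mem_filter.2 ⟨hd', hd, _, h4⟩
  rw [← e3] at hd2
  obtain ⟨hd3, w, hw⟩ := (Finset.mem_filter.1 hd2).2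
  obtain rfl := run_unique hU h4 hw
  exact hn ⟨p, hp', q, hq', d, hd3, h1', h2', h3, hw⟩

/-- Fewer than `2 ^ (8 * ε)` pairs `(y, z)` are covered for a given `x`: such a pair is determined
by a program for `[p, q]` and two short programs. -/
theorem exists_not_covered (hU : IsStaging U run) (s ε : ℕ) (x : List Bool) :
    ∃ y z : List Bool, y.length = 3 * ε ∧ z.length = 5 * ε ∧ ¬ Covered run s ε x y z := by
  by_contra hall
  push Not at hall
  have hle : (stringsOfLength (3 * ε) ×ˢ stringsOfLength (5 * ε)).card ≤
      (shortStrings (6 * ε - 2) ×ˢ shortStrings ε ×ˢ shortStrings ε).card := by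
    refine Finset.card_le_card_of_forall_subsingleton
      (fun v w => ∃ p q, run s w.1 [] = some (pairStr p q) ∧
        run s w.2.1 (pairStr p x) = some v.1 ∧ run s w.2.2 (pairStr q v.1) = some v.2) ?_ ?_
    · rintro ⟨y, z⟩ hv
      simp only [Finset.mem_product, mem_stringsOfLength] at hv
      obtain ⟨p, -, q, -, d, -, ⟨a, -, e, -, -, he, -, h1⟩, ⟨b, -, f, -, -, hf, -, h2⟩, hd, h3⟩ :=
        hall y z hv.1 hv.2
      refine ⟨(d, e, f), ?_, p, q, h3, h1, h2⟩
      simp only [Finset.mem_product, mem_shortStrings]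
      omega
    · rintro ⟨d, e, f⟩ - ⟨y, z⟩ ⟨-, p, q, h1, h2, h3⟩ ⟨y', z'⟩ ⟨-, p', q', h1', h2', h3'⟩
      obtain ⟨rfl, rfl⟩ := pairStr_inj (run_unique hU h1 h1')
      obtain rfl := run_unique hU h2 h2'
      obtain rfl := run_unique hU h3 h3'
      rfl
  rw [Finset.card_product, Finset.card_product, Finset.card_product, card_stringsOfLength,
    card_stringsOfLength, ← pow_add] at hle
  have h1 := four_mul_card_shortStrings_le (6 * ε)
  have h2 := (card_shortStrings_lt ε).le
  have h3 : 4 * 2 ^ (3 * ε + 5 * ε) ≤ 2 ^ (6 * ε) * (2 ^ ε * 2 ^ ε) :=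
    calc 4 * 2 ^ (3 * ε + 5 * ε)
        ≤ 4 * ((shortStrings (6 * ε - 2)).card *
            ((shortStrings ε).card * (shortStrings ε).card)) := by omega
      _ = 4 * (shortStrings (6 * ε - 2)).card *
            ((shortStrings ε).card * (shortStrings ε).card) := by ring
      _ ≤ 2 ^ (6 * ε) * (2 ^ ε * 2 ^ ε) := by gcongr
  rw [← pow_add, ← pow_add, show 6 * ε + (ε + ε) = 3 * ε + 5 * ε by ring] at h3
  have : 0 < 2 ^ (3 * ε + 5 * ε) := by positivity
  omega

end Counting

/-- The pair of strings with code `n`. -/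
def stringPair (n : ℕ) : List Bool × List Bool :=
  (Encodable.decode n).getD ([], [])

theorem stringPair_encode (v : List Bool × List Bool) : stringPair (Encodable.encode v) = v := by
  simp [stringPair]

theorem primrec_stringPair : Primrec stringPair :=
  Primrec.option_getD.comp Primrec.decode (Primrec.const _)

/-! ### The computable strategy and its analysis -/

section Strategy

variable (run : ℕ → List Bool → List Bool → Option (List Bool))

/-- `n` codes a pair `(y, z)` of the right lengths that is not covered for `x` at stage `s`. -/
def IsCandidate (ε : ℕ) (x : List Bool) (s n : ℕ) : Prop :=
  (stringPair n).1.length = 3 * ε ∧ (stringPair n).2.length = 5 * ε ∧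
    ¬ Covered run s ε x (stringPair n).1 (stringPair n).2

/-- `n` codes a pair of strings of length `5 * ε`. -/
def IsRound (ε n : ℕ) : Prop :=
  (stringPair n).1.length = 5 * ε ∧ (stringPair n).2.length = 5 * ε ∧
    Encodable.encode (stringPair n) = n

open Classical in
/-- The first candidate for `x` at stage `s`. -/
noncomputable def firstCandidate (ε : ℕ) (x : List Bool) (s : ℕ) : Part ℕ :=
  Nat.rfind fun n => Part.some (decide (IsCandidate run ε x s n))

open Classical in
/-- The first stage at which the triple of `x` and the pair with code `n` is covered. -/
noncomputable def coverStage (ε : ℕ) (x : List Bool) (n : ℕ) : Part ℕ :=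
  Nat.rfind fun s =>
    Part.some (decide (Covered run s ε x (stringPair n).1 (stringPair n).2))

open Classical in
/-- The stage reached before round `n`: a round `(x, w)` takes the first candidate for `x` and
waits until it is covered. -/
noncomputable def roundStage (ε : ℕ) : ℕ → Part ℕ
  | 0 => Part.some 0
  | n + 1 => (roundStage ε n).bind fun s =>
      bif decide (IsRound ε n) then
        (firstCandidate run ε (stringPair n).1 s).bind (coverStage run ε (stringPair n).1)
      else Part.some s

/-- The language that maps the program `w` and the input `x`, both of length `5 * ε`, to the pair
chosen in round `(x, w)`. -/
noncomputable def strategy (w x : List Bool) : Part (List Bool) :=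
  (roundStage run (w.length / 5) (Encodable.encode (x, w))).bind fun s =>
    (firstCandidate run (w.length / 5) x s).map fun n =>
      pairStr (stringPair n).1 (stringPair n).2

variable {run} {U : List Bool → List Bool →. List Bool}

theorem partrec_firstCandidate (hU : IsStaging U run) :
    Partrec fun v : ℕ × List Bool × ℕ => firstCandidate run v.1 v.2.1 v.2.2 := by
  classical
  refine Partrec.rfind ?_
  have hp : Primrec fun v : (ℕ × List Bool × ℕ) × ℕ => stringPair v.2 :=
    primrec_stringPair.comp Primrec.snd
  have hε : Primrec fun v : (ℕ × List Bool × ℕ) × ℕ => v.1.1 := Primrec.fst.comp Primrec.fst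
  have hx : Primrec fun v : (ℕ × List Bool × ℕ) × ℕ => v.1.2.1 :=
    Primrec.fst.comp (Primrec.snd.comp Primrec.fst)
  have hs : Primrec fun v : (ℕ × List Bool × ℕ) × ℕ => v.1.2.2 :=
    Primrec.snd.comp (Primrec.snd.comp Primrec.fst)
  have h : PrimrecPred fun v : (ℕ × List Bool × ℕ) × ℕ =>
      IsCandidate run v.1.1 v.1.2.1 v.1.2.2 v.2 := by
    refine PrimrecPred.and (Primrec.eq.comp (Primrec.list_length.comp (Primrec.fst.comp hp))
      (Primrec.nat_mul.comp (Primrec.const 3) hε)) (PrimrecPred.and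
      (Primrec.eq.comp (Primrec.list_length.comp (Primrec.snd.comp hp))
        (Primrec.nat_mul.comp (Primrec.const 5) hε)) (PrimrecPred.not ?_))
    exact primrecPred_covered hU.primrec hs hε hx (Primrec.fst.comp hp) (Primrec.snd.comp hp)
  exact h.decide.to_comp.partrec

theorem partrec_coverStage (hU : IsStaging U run) :
    Partrec fun v : ℕ × List Bool × ℕ => coverStage run v.1 v.2.1 v.2.2 := by
  classical
  refine Partrec.rfind ?_
  have hp : Primrec fun v : (ℕ × List Bool × ℕ) × ℕ => stringPair v.1.2.2 :=
    primrec_stringPair.comp (Primrec.snd.comp (Primrec.snd.comp Primrec.fst))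
  have h : PrimrecPred fun v : (ℕ × List Bool × ℕ) × ℕ =>
      Covered run v.2 v.1.1 v.1.2.1 (stringPair v.1.2.2).1 (stringPair v.1.2.2).2 :=
    primrecPred_covered hU.primrec Primrec.snd (Primrec.fst.comp Primrec.fst)
      (Primrec.fst.comp (Primrec.snd.comp Primrec.fst)) (Primrec.fst.comp hp)
      (Primrec.snd.comp hp)
  exact h.decide.to_comp.partrec

theorem primrecPred_isRound : PrimrecPred fun v : ℕ × ℕ => IsRound v.1 v.2 := by
  have hp : Primrec fun v : ℕ × ℕ => stringPair v.2 := primrec_stringPair.comp Primrec.snd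
  have h5 : Primrec fun v : ℕ × ℕ => 5 * v.1 :=
    Primrec.nat_mul.comp (Primrec.const 5) Primrec.fst
  exact PrimrecPred.and (Primrec.eq.comp (Primrec.list_length.comp (Primrec.fst.comp hp)) h5)
    (PrimrecPred.and (Primrec.eq.comp (Primrec.list_length.comp (Primrec.snd.comp hp)) h5)
      (Primrec.eq.comp (Primrec.encode.comp hp) Primrec.snd))

open Classical in
theorem computable_decide_isRound : Computable fun v : ℕ × ℕ => decide (IsRound v.1 v.2) :=
  primrecPred_isRound.decide.to_comp

open Classical in
theorem partrec_roundStage (hU : IsStaging U run) :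
    Partrec fun v : ℕ × ℕ => roundStage run v.1 v.2 := by
  have hε : Computable fun v : (ℕ × ℕ) × ℕ × ℕ => v.1.1 := Computable.fst.comp Computable.fst
  have hn : Computable fun v : (ℕ × ℕ) × ℕ × ℕ => v.2.1 := Computable.fst.comp Computable.snd
  have hs : Computable fun v : (ℕ × ℕ) × ℕ × ℕ => v.2.2 := Computable.snd.comp Computable.snd
  have hx : Computable fun v : (ℕ × ℕ) × ℕ × ℕ => (stringPair v.2.1).1 :=
    Computable.fst.comp (primrec_stringPair.to_comp.comp hn)
  have hc : Computable fun v : (ℕ × ℕ) × ℕ × ℕ => decide (IsRound v.1.1 v.2.1) :=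
    computable_decide_isRound.comp (g := fun v : (ℕ × ℕ) × ℕ × ℕ => (v.1.1, v.2.1)) (hε.pair hn)
  have h1 : Partrec fun v : (ℕ × ℕ) × ℕ × ℕ =>
      firstCandidate run v.1.1 (stringPair v.2.1).1 v.2.2 :=
    (partrec_firstCandidate hU).comp
      (g := fun v : (ℕ × ℕ) × ℕ × ℕ => (v.1.1, (stringPair v.2.1).1, v.2.2)) (hε.pair (hx.pair hs))
  have h2 : Partrec fun v : ((ℕ × ℕ) × ℕ × ℕ) × ℕ =>
      coverStage run v.1.1.1 (stringPair v.1.2.1).1 v.2 :=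
    (partrec_coverStage hU).comp
      (g := fun v : ((ℕ × ℕ) × ℕ × ℕ) × ℕ => (v.1.1.1, (stringPair v.1.2.1).1, v.2))
      ((hε.comp Computable.fst).pair
      ((hx.comp Computable.fst).pair Computable.snd))
  have hstep : Partrec₂ fun (v : ℕ × ℕ) (u : ℕ × ℕ) => bif decide (IsRound v.1 u.1) then
      (firstCandidate run v.1 (stringPair u.1).1 u.2).bind
        (coverStage run v.1 (stringPair u.1).1)
      else Part.some u.2 :=
    Partrec.cond hc (h1.bind h2) hs.partrec
  have h := Partrec.nat_rec (Computable.snd (α := ℕ) (β := ℕ)) (Computable.const 0).partrec hstep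
  refine h.of_eq fun v => ?_
  obtain ⟨ε, n⟩ := v
  induction n with
  | zero => simp only [roundStage]; rfl
  | succ n ih =>
    simp only at ih
    simp only [roundStage, ← ih]
    rfl

/-- Optimality of `U` applied to this language bounds C(y,z|x); the parameter ε is recovered from
the length of the program. -/
theorem isProgrammingLanguage_strategy (hU : IsStaging U run) :
    IsProgrammingLanguage (strategy run) := by
  have hw : Computable fun v : List Bool × List Bool => v.1.length / 5 :=
    (Primrec.nat_div.comp (Primrec.list_length.comp Primrec.fst) (Primrec.const 5)).to_comp
  have h1 : Partrec fun v : List Bool × List Bool =>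
      roundStage run (v.1.length / 5) (Encodable.encode (v.2, v.1)) :=
    (partrec_roundStage hU).comp (hw.pair
      (Computable.encode.comp (Computable.snd.pair Computable.fst)))
  have h2 : Partrec fun v : (List Bool × List Bool) × ℕ =>
      firstCandidate run (v.1.1.length / 5) v.1.2 v.2 :=
    (partrec_firstCandidate hU).comp ((hw.comp Computable.fst).pair
      ((Computable.snd.comp Computable.fst).pair Computable.snd))
  have h3 : Computable fun n : ℕ => pairStr (stringPair n).1 (stringPair n).2 :=
    (primrec_pairStr.comp (Primrec.fst.comp primrec_stringPair)
      (Primrec.snd.comp primrec_stringPair)).to_comp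
  exact h1.bind (h2.map (h3.comp Computable.snd).to₂).to₂

theorem exists_mem_firstCandidate (hU : IsStaging U run) (ε : ℕ) (x : List Bool) (s : ℕ) :
    ∃ n ∈ firstCandidate run ε x s, IsCandidate run ε x s n := by
  classical
  obtain ⟨y, z, hy, hz, hn⟩ := exists_not_covered hU s ε x
  obtain ⟨n, hn, -⟩ := Nat.rfind_min' (p := fun n => decide (IsCandidate run ε x s n))
    (m := Encodable.encode (y, z))
    (by
      rw [decide_eq_true_iff, IsCandidate, stringPair_encode]
      exact ⟨hy, hz, hn⟩)
  exact ⟨n, hn, by simpa using Nat.rfind_spec hn⟩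

theorem exists_mem_coverStage {ε s n : ℕ} {x : List Bool}
    (h : Covered run s ε x (stringPair n).1 (stringPair n).2) :
    ∃ s' ∈ coverStage run ε x n, Covered run s' ε x (stringPair n).1 (stringPair n).2 := by
  classical
  obtain ⟨s', hs', -⟩ := Nat.rfind_min'
    (p := fun s => decide (Covered run s ε x (stringPair n).1 (stringPair n).2)) (m := s)
    (by simpa using h)
  exact ⟨s', hs', by simpa using Nat.rfind_spec hs'⟩

open Classical in
/-- If every triple chosen in some round is eventually covered, then each round makes progress. -/
theorem exists_mem_roundStage (hU : IsStaging U run) {ε : ℕ}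
    (hcov : ∀ w x y z : List Bool, w.length = 5 * ε → x.length = 5 * ε → y.length = 3 * ε →
      z.length = 5 * ε → pairStr y z ∈ strategy run w x → ∃ s, Covered run s ε x y z) (n : ℕ) :
    ∃ s ∈ roundStage run ε n, ((Finset.range n).filter (IsRound ε)).card ≤ eventCount run ε s := by
  induction n with
  | zero => exact ⟨0, Part.mem_some 0, by simp⟩
  | succ n ih =>
    obtain ⟨s, hs, hcard⟩ := ih
    rw [Finset.range_add_one, Finset.filter_insert]
    by_cases hn : IsRound ε n
    · rw [if_pos hn]
      obtain ⟨hx, hw, he⟩ := id hn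
      obtain ⟨m, hm, hy, hz, hnc⟩ := exists_mem_firstCandidate hU ε (stringPair n).1 s
      have hdiv : (stringPair n).2.length / 5 = ε := by omega
      -- Since `n` is the code of (x, w), the strategy on `w` and `x` outputs exactly the candidate
      -- of this round. The code condition in `IsRound` excludes numbers that decode only by
      -- default.
      obtain ⟨t, ht⟩ := hcov (stringPair n).2 (stringPair n).1 _ _ hw hx hy hz (by
        unfold strategy
        rw [hdiv, Prod.mk.eta, he]
        exact Part.mem_bind hs (Part.mem_map _ hm))
      obtain ⟨s', hs', hc⟩ := exists_mem_coverStage ht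
      refine ⟨s', ?_, ?_⟩
      · rw [roundStage]
        refine Part.mem_bind hs ?_
        simpa only [hn, decide_true, cond_true] using Part.mem_bind hm hs'
      · have := eventCount_lt_eventCount hU hx hy hnc hc
        have := Finset.card_insert_le n ((Finset.range n).filter (IsRound ε))
        omega
    · rw [if_neg hn]
      refine ⟨s, ?_, hcard⟩
      rw [roundStage]
      refine Part.mem_bind hs ?_
      simp only [hn, decide_false, cond_false, Part.mem_some_iff]

theorem exists_card_rounds (ε : ℕ) [DecidablePred (IsRound ε)] :
    ∃ n, 2 ^ (10 * ε) ≤ ((Finset.range n).filter (IsRound ε)).card := by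
  set S := (stringsOfLength (5 * ε) ×ˢ stringsOfLength (5 * ε)).image Encodable.encode with hS
  refine ⟨S.sup id + 1, ?_⟩
  have hcard : S.card = 2 ^ (10 * ε) := by
    rw [hS, Finset.card_image_of_injective _ Encodable.encode_injective, Finset.card_product,
      card_stringsOfLength, ← pow_add]
    congr 1
    ring
  rw [← hcard]
  refine Finset.card_le_card fun k hk => ?_
  refine Finset.mem_filter.2 ⟨Finset.mem_range.2 (Nat.lt_succ_of_le (Finset.le_sup (f := id) hk)), ?_⟩
  obtain ⟨v, hv, rfl⟩ := Finset.mem_image.1 hk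
  simp only [Finset.mem_product, mem_stringsOfLength] at hv
  simpa [IsRound, stringPair_encode] using hv

/-- Otherwise every round would finish, and the 2^(10ε) rounds would need as many distinct events.
-/
theorem exists_never_covered (hU : IsStaging U run) (ε : ℕ) :
    ∃ w x y z : List Bool, w.length = 5 * ε ∧ x.length = 5 * ε ∧ y.length = 3 * ε ∧
      z.length = 5 * ε ∧ pairStr y z ∈ strategy run w x ∧ ∀ s, ¬ Covered run s ε x y z := by
  classical
  by_contra hall
  push Not at hall
  obtain ⟨n, hn⟩ := exists_card_rounds ε
  obtain ⟨s, -, hs⟩ := exists_mem_roundStage hU hall n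
  exact (eventCount_lt run ε s).not_ge (hn.trans hs)

theorem exists_covered (hU : IsStaging U run) {ε : ℕ} {x y z p q a b d e f : List Bool}
    (ha : p ∈ U a []) (hal : a.length + 2 < 4 * ε) (hb : q ∈ U b []) (hbl : b.length + 2 < 6 * ε)
    (hd : pairStr p q ∈ U d []) (hdl : d.length + 2 < 6 * ε) (he : y ∈ U e (pairStr p x))
    (hel : e.length < ε) (hf : z ∈ U f (pairStr q y)) (hfl : f.length < ε) :
    ∃ s, Covered run s ε x y z := by
  obtain ⟨s1, h1⟩ := hU.complete.1 ha
  obtain ⟨s2, h2⟩ := hU.complete.1 hb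
  obtain ⟨s3, h3⟩ := hU.complete.1 hd
  obtain ⟨s4, h4⟩ := hU.complete.1 he
  obtain ⟨s5, h5⟩ := hU.complete.1 hf
  -- A common stage by which all programs and intermediate strings are enumerated.
  obtain ⟨t, ht⟩ : ∃ t, ∀ w ∈ [a, b, d, e, f, p, q], w ∈ stringsBelow t := by
    generalize [a, b, d, e, f, p, q] = l
    induction l with
    | nil => exact ⟨0, by simp⟩
    | cons w l ih =>
      obtain ⟨t, ht⟩ := ih
      obtain ⟨t', ht'⟩ := exists_mem_stringsBelow w
      refine ⟨max t t', fun v hv => ?_⟩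
      rcases List.mem_cons.1 hv with rfl | hv
      · exact stringsBelow_mono (le_max_right _ _) ht'
      · exact stringsBelow_mono (le_max_left _ _) (ht v hv)
  have hmem : ∀ w ∈ [a, b, d, e, f, p, q], w ∈ stringsBelow (t + s1 + s2 + s3 + s4 + s5) :=
    fun w hw => stringsBelow_mono (by omega) (ht w hw)
  simp only [List.forall_mem_cons] at hmem
  obtain ⟨ma, mb, md, me, mf, mp, mq, -⟩ := hmem
  exact ⟨t + s1 + s2 + s3 + s4 + s5, p, mp, q, mq, d, md,
    ⟨a, ma, e, me, hal, hel, hU.mono (by omega) h1, hU.mono (by omega) h4⟩,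
    ⟨b, mb, f, mf, hbl, hfl, hU.mono (by omega) h2, hU.mono (by omega) h5⟩,
    hdl, hU.mono (by omega) h3⟩

end Strategy

/-! ### From the game to complexities -/

theorem condC_le_length {U : List Bool → List Bool →. List Bool} {p x y : List Bool}
    (h : x ∈ U p y) : condC U x y ≤ p.length :=
  Nat.sInf_le ⟨p, rfl, h⟩

theorem theorem5 (U : List Bool → List Bool →. List Bool) (hU : IsOptimal U) :
    ∃ c : ℕ, ∀ ε : ℕ, ∃ x y z : List Bool,
      x.length ≤ 5 * ε + c ∧ y.length ≤ 5 * ε + c ∧ z.length ≤ 5 * ε + c ∧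
      ∀ p q : List Bool,
        condC U y (pairStr p x) < ε →
        condC U z (pairStr q y) < ε →
        (plainC U p : ℤ) < (condC U y x : ℤ) + ε - c →
        (plainC U q : ℤ) < (condC U z y : ℤ) + ε - c →
        (plainC U (pairStr p q) : ℤ) ≥
          max (condC U (pairStr y z) x : ℤ) (condC U z y : ℤ) + ε - c := by
  obtain ⟨run, hrun⟩ := exists_isStaging hU.1
  obtain ⟨t, ht⟩ := hU.2 (fun p _ => Part.some p) Computable.fst
  obtain ⟨t', ht'⟩ := hU.2 _ (isProgrammingLanguage_strategy hrun)
  have hself : ∀ x y, condC U x y ≤ t.length + x.length := fun x y =>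
    (condC_le_length (by rw [ht]; exact Part.mem_some x)).trans (List.length_append).le
  -- `t` and `t'` pay for simulating the copying language and the strategy; the 2 is the slack used
  -- in the counting.
  refine ⟨t.length + t'.length + 2, fun ε => ?_⟩
  obtain ⟨w, x, y, z, hw, hx, hy, hz, hmem, hnc⟩ := exists_never_covered hrun ε
  refine ⟨x, y, z, by omega, by omega, by omega, fun p q hyp hzq hp hq => ?_⟩
  by_contra hlt
  have hyz : condC U (pairStr y z) x ≤ t'.length + w.length :=
    (condC_le_length (by rw [ht']; exact hmem)).trans (List.length_append).le
  have hyx := hself y x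
  have hzy := hself z y
  obtain ⟨a, hal, ha⟩ := exists_program_of_isOptimal hU p []
  obtain ⟨b, hbl, hb⟩ := exists_program_of_isOptimal hU q []
  obtain ⟨d, hdl, hd⟩ := exists_program_of_isOptimal hU (pairStr p q) []
  obtain ⟨e, hel, he⟩ := exists_program_of_isOptimal hU y (pairStr p x)
  obtain ⟨f, hfl, hf⟩ := exists_program_of_isOptimal hU z (pairStr q y)
  unfold plainC at hp hq hlt
  push_cast at hp hq hlt
  -- The bound for `d` needs both terms of the maximum to be at most 5ε + c - 2.
  obtain ⟨s, hs⟩ := exists_covered (ε := ε) hrun ha (by omega) hb (by omega) hd (by omega) he (by omega)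
    hf (by omega)
  exact hnc s hs
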